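/- For positive integers $i_1,\dots,i_k$ with $i_1>1$ let $$\zeta(i_1,\dots,i_k)=\sum_{n_1>\dots>n_k\ge 1}\frac{1}{n_1^{i_1}\cdots n_k^{i_k}}$$ be the multiple zeta value of weight $i_1+\dots+i_k$ and depth $k$, and let $$E(2n,k)=\sum_{\substack{i_1,\dots,i_k\ \text{positive even}\\ i_1+\dots+i_k=2n}}\zeta(i_1,\dots,i_k).$$ Let $B_m$ denote the $m$-th Bernoulli number. Then for all integers $1\le k\le n$ every series $\zeta(i_1,\dots,i_k)$ occurring in $E(2n,k)$ converges, and $$E(2n,k)=\frac{(-1)^{n-k-1}\pi^{2n}}{(2n+1)!}\sum_{i=0}^{n-k}\binom{n-i}{k}\binom{2n+1}{2i}\,2\,(2^{2i-1}-1)\,B_{2i}.$$ -/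

import Mathlib

/-- The set of summation indices `n₁ > ⋯ > n_k ≥ 1`. -/
abbrev MZVIndex (k : ℕ) : Type :=
  {m : Fin k → ℕ // StrictAnti m ∧ ∀ j, 1 ≤ m j}

/-- The term `1 / (n₁ ^ i₁ ⋯ n_k ^ i_k)`. -/
noncomputable def mzvTerm {k : ℕ} (i : Fin k → ℕ) (m : MZVIndex k) : ℝ :=
  1 / ∏ j, (m.1 j : ℝ) ^ i j

/-- The multiple zeta value `ζ(i₁, …, i_k)`. -/
noncomputable def multiZeta {k : ℕ} (i : Fin k → ℕ) : ℝ :=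
  ∑' m : MZVIndex k, mzvTerm i m

/-- The `k`-tuples of positive even integers with sum `w`. -/
def evenCompositions (w k : ℕ) : Finset (Fin k → ℕ) :=
  (Finset.Nat.antidiagonalTuple k w).filter fun i => ∀ j, 0 < i j ∧ Even (i j)

/-- `E(w, k)`: the sum of all multiple zeta values of weight `w` and depth `k`
whose arguments are (positive) even integers. -/
noncomputable def evenMZVSum (w k : ℕ) : ℝ :=
  ∑ i ∈ evenCompositions w k, multiZeta i

/-! Put `y_m = 1/m²`, `P = ∏ (1 - y_m X)` and `g_m = y_m X / (1 - y_m X)`, with `m ≤ N`. The `X^n`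
coefficient of the elementary symmetric sum `e_k(g)` is the truncation of E(2n,k), since expanding
each `g_m` assigns a positive even exponent to each index. Moreover `P((1+t)X) = P(X) ∏ (1 - t
g_m)`; comparing coefficients of `t^k X^a` shows that multiplying `e_k(g)` by `P` only scales each
coefficient of `P` by `(-1)^k binom(a,k)`. As N → ∞, `P` tends coefficientwise to sin(π√X)/(π√X).
Multiplying by the reciprocal series, whose coefficients are Bernoulli numbers, isolates E(2n,k). -/

/-! ### The finite product identity -/

open Finset PowerSeries in
theorem coeff_prod_one_sub_mul_sum_prod {R : Type*} [CommRing R] (y : ℕ → R)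
    (g : ℕ → PowerSeries R) (hg : ∀ m, (1 - C (y m) * X) * g m = C (y m) * X)
    (s : Finset ℕ) (a k : ℕ) :
    coeff a ((∏ m ∈ s, (1 - C (y m) * X)) * ∑ T ∈ s.powersetCard k, ∏ m ∈ T, g m) =
      (-1) ^ k * (a.choose k : R) * coeff a (∏ m ∈ s, (1 - C (y m) * X)) := by
  induction s using Finset.induction_on generalizing a k with
  | empty =>
    cases k with
    | zero => simp
    | succ k =>
      rw [powersetCard_eq_empty.2 (by simp)]
      cases a <;> simp [coeff_one]
  | insert x s hx ih =>
    cases k with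
    | zero => simp
    | succ k =>
      have hsum : ∑ T ∈ (insert x s).powersetCard (k + 1), ∏ m ∈ T, g m =
          ∑ T ∈ s.powersetCard (k + 1), ∏ m ∈ T, g m +
            g x * ∑ T ∈ s.powersetCard k, ∏ m ∈ T, g m := by
        have hx' : ∀ T ∈ s.powersetCard k, x ∉ T := fun T hT h =>
          hx ((mem_powersetCard.1 hT).1 h)
        rw [powersetCard_succ_insert hx, sum_union, sum_image, mul_sum]
        · exact congrArg _ (sum_congr rfl fun T hT => prod_insert (hx' T hT))
        · intro T hT U hU h
          rw [← erase_insert (hx' T hT), h, erase_insert (hx' U hU)]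
        · rw [disjoint_left]
          intro T hT hT'
          obtain ⟨U, -, rfl⟩ := mem_image.1 hT'
          exact hx ((mem_powersetCard.1 hT).1 (mem_insert_self _ _))
      rw [hsum, prod_insert hx]
      set P := ∏ m ∈ s, (1 - C (y m) * X)
      -- The new factor turns `g x` into `C (y x) * X`, so that only index shifts remain and
      -- Pascal's rule closes the induction.
      have key : (1 - C (y x) * X) * P * (∑ T ∈ s.powersetCard (k + 1), ∏ m ∈ T, g m +
            g x * ∑ T ∈ s.powersetCard k, ∏ m ∈ T, g m) =
          P * ∑ T ∈ s.powersetCard (k + 1), ∏ m ∈ T, g m -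
            C (y x) * (X * (P * ∑ T ∈ s.powersetCard (k + 1), ∏ m ∈ T, g m)) +
            C (y x) * (X * (P * ∑ T ∈ s.powersetCard k, ∏ m ∈ T, g m)) := by
        linear_combination (P * ∑ T ∈ s.powersetCard k, ∏ m ∈ T, g m) * hg x
      have key2 : (1 - C (y x) * X) * P = P - C (y x) * (X * P) := by ring
      rw [key, key2]
      cases a with
      | zero => simp only [map_add, map_sub, coeff_C_mul, coeff_zero_X_mul, ih]; simp
      | succ a =>
        simp only [map_add, map_sub, coeff_C_mul, coeff_succ_X_mul, ih,
          Nat.choose_succ_succ' a k, Nat.cast_add]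
        ring

/-! ### Bernoulli identities from hyperbolic functions -/

open Finset in
theorem sum_antidiagonal_two_mul_add_one {M : Type*} [AddCommMonoid M] (n : ℕ) (f : ℕ × ℕ → M)
    (hf : ∀ p : ℕ × ℕ, Odd p.1 → f p = 0) :
    ∑ p ∈ antidiagonal (2 * n + 1), f p = ∑ p ∈ antidiagonal n, f (2 * p.1, 2 * p.2 + 1) := by
  symm
  refine sum_of_injOn (fun p => (2 * p.1, 2 * p.2 + 1)) ?_ ?_ ?_ ?_
  · rintro ⟨a, b⟩ - ⟨c, d⟩ - h
    simp only [Prod.mk.injEq] at h ⊢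
    omega
  · rintro ⟨a, b⟩ h
    simp only [mem_coe, HasAntidiagonal.mem_antidiagonal] at h ⊢
    omega
  · rintro ⟨a, b⟩ h h'
    refine hf _ (Nat.not_even_iff_odd.1 fun he => h' ?_)
    obtain ⟨c, rfl⟩ := he
    rw [HasAntidiagonal.mem_antidiagonal] at h
    refine ⟨(c, n - c), ?_, ?_⟩
    · simp only [mem_coe, HasAntidiagonal.mem_antidiagonal]
      omega
    · simp only [Prod.mk.injEq]
      omega
  · intros; rfl

namespace PowerSeries

theorem rescale_bernoulli_mul_exp (a : ℚ) :
    rescale a (bernoulliPowerSeries ℚ) * (rescale a (exp ℚ) - 1) = C a * X := by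
  have := congrArg (rescale a) (bernoulliPowerSeries_mul_exp_sub_one ℚ)
  simpa [rescale_X] using this

theorem rescale_two_exp : rescale (2 : ℚ) (exp ℚ) = exp ℚ * exp ℚ := by
  have := exp_pow_eq_rescale_exp (A := ℚ) 2
  rw [← sq, this]; norm_num

/-- With B(X) = X/(e^X - 1), this says 2B(X) - B(2X) = X / sinh X. -/
theorem bernoulli_mul_exp_sub_exp_neg :
    (2 * bernoulliPowerSeries ℚ - rescale 2 (bernoulliPowerSeries ℚ)) *
      (exp ℚ - evalNegHom (exp ℚ)) = 2 * X := by
  have h1 := bernoulliPowerSeries_mul_exp_sub_one ℚ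
  have h2 := rescale_bernoulli_mul_exp 2
  have h3 := exp_mul_exp_neg_eq_one (A := ℚ)
  have hC : (C (2 : ℚ)) = 2 := map_ofNat _ 2
  rw [rescale_two_exp, hC] at h2
  set E := exp ℚ
  set F := evalNegHom E
  set B := bernoulliPowerSeries ℚ
  set D := rescale 2 B
  linear_combination (2 * (1 + E) * F) * h1 - F * h2 + (2 * X - (2 * B - D) * E) * h3

/-- This is B(2X) + X = X coth X; it yields the recursion matching Euler's values ζ(2j). -/
theorem rescale_bernoulli_add_X_mul_exp_sub_exp_neg :
    (rescale 2 (bernoulliPowerSeries ℚ) + X) * (exp ℚ - evalNegHom (exp ℚ)) =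
      X * (exp ℚ + evalNegHom (exp ℚ)) := by
  have h2 := rescale_bernoulli_mul_exp 2
  have h3 := exp_mul_exp_neg_eq_one (A := ℚ)
  have hC : (C (2 : ℚ)) = 2 := map_ofNat _ 2
  rw [rescale_two_exp, hC] at h2
  set E := exp ℚ
  set F := evalNegHom E
  set B := bernoulliPowerSeries ℚ
  set D := rescale 2 B
  linear_combination F * h2 - D * E * h3

theorem coeff_exp_sub_exp_neg (n : ℕ) :
    coeff (2 * n + 1) (exp ℚ - evalNegHom (exp ℚ)) = 2 / (2 * n + 1).factorial := by
  simp [evalNegHom, coeff_rescale, pow_succ, pow_mul]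
  ring

theorem coeff_exp_add_exp_neg (n : ℕ) :
    coeff (2 * n) (exp ℚ + evalNegHom (exp ℚ)) = 2 / (2 * n).factorial := by
  simp [evalNegHom, coeff_rescale, pow_mul]
  ring

end PowerSeries

open Finset PowerSeries in
theorem sum_bernoulli_div_factorial (n : ℕ) :
    ∑ p ∈ antidiagonal n, (2 ^ (2 * p.1) * bernoulli (2 * p.1) / (2 * p.1).factorial : ℚ) *
      (1 / (2 * p.2 + 1).factorial) = 1 / (2 * n).factorial := by
  have h := congrArg (coeff (2 * n + 1)) rescale_bernoulli_add_X_mul_exp_sub_exp_neg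
  rw [coeff_mul, sum_antidiagonal_two_mul_add_one, coeff_succ_X_mul, coeff_exp_add_exp_neg] at h
  · have h' : ∀ p ∈ antidiagonal n, coeff (2 * p.1) (rescale 2 (bernoulliPowerSeries ℚ) + X) *
        coeff (2 * p.2 + 1) (exp ℚ - evalNegHom (exp ℚ)) =
        2 * ((2 ^ (2 * p.1) * bernoulli (2 * p.1) / (2 * p.1).factorial : ℚ) *
      (1 / (2 * p.2 + 1).factorial)) := by
      intro p _
      rw [coeff_exp_sub_exp_neg, map_add, coeff_rescale, coeff_X, if_neg (by omega)]
      simp [bernoulliPowerSeries]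
      ring
    rw [sum_congr rfl h', ← mul_sum] at h
    linear_combination h / 2
  · rintro ⟨a, b⟩ ha
    simp only [map_add, coeff_rescale, coeff_X]
    -- At index 1 the term 2B₁ = -1 cancels the added `X`; the other odd Bernoulli numbers vanish.
    split_ifs with h1
    · subst h1
      simp [bernoulliPowerSeries]
      norm_num
    · have ha' : Odd a := ha
      simp [bernoulliPowerSeries,
        bernoulli_eq_zero_of_odd ha' (by have := ha'.pos; omega)]

open Finset PowerSeries in
theorem sum_two_sub_two_pow_bernoulli (n : ℕ) :
    ∑ p ∈ antidiagonal n, ((2 - 2 ^ (2 * p.1)) * bernoulli (2 * p.1) / (2 * p.1).factorial : ℚ) *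
      (1 / (2 * p.2 + 1).factorial) = if n = 0 then 1 else 0 := by
  have hC : (C (2 : ℚ)) = 2 := map_ofNat _ 2
  have h := congrArg (coeff (2 * n + 1)) bernoulli_mul_exp_sub_exp_neg
  rw [coeff_mul, sum_antidiagonal_two_mul_add_one, ← hC, coeff_C_mul, coeff_X] at h
  · have h' : ∀ p ∈ antidiagonal n,
        coeff (2 * p.1) (C 2 * bernoulliPowerSeries ℚ - rescale 2 (bernoulliPowerSeries ℚ)) *
        coeff (2 * p.2 + 1) (exp ℚ - evalNegHom (exp ℚ)) =
        2 * (((2 - 2 ^ (2 * p.1)) * bernoulli (2 * p.1) / (2 * p.1).factorial : ℚ) *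
      (1 / (2 * p.2 + 1).factorial)) := by
      intro p _
      rw [coeff_exp_sub_exp_neg, map_sub, coeff_rescale, coeff_C_mul]
      simp [bernoulliPowerSeries]
      ring
    rw [sum_congr rfl h', ← mul_sum] at h
    have e : (2 * n + 1 = 1) = (n = 0) := by simp
    simp only [e] at h
    linear_combination h / 2
  · rintro ⟨a, b⟩ ha
    have ha' : Odd a := ha
    rw [← hC]
    simp only [map_sub, coeff_rescale, coeff_C_mul]
    rcases eq_or_ne a 1 with rfl | h1
    · simp
    · simp [bernoulliPowerSeries,
        bernoulli_eq_zero_of_odd ha' (by have := ha'.pos; omega)]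

/-! ### Truncated generating series and limit coefficients -/

/-- The power series `∑_{c ≥ 1} X ^ c / m ^ (2 c)`. -/
noncomputable def invSqGeom (m : ℕ) : PowerSeries ℝ :=
  PowerSeries.mk fun c => if c = 0 then 0 else (1 / (m : ℝ) ^ 2) ^ c

/-- The truncation `∏_{1 ≤ m ≤ N} (1 - X / m ^ 2)` of Euler's product for the sine. -/
noncomputable def sineTrunc (N : ℕ) : PowerSeries ℝ :=
  ∏ m ∈ Finset.Icc 1 N, (1 - PowerSeries.C (1 / (m : ℝ) ^ 2) * PowerSeries.X)

/-- The generating series of the truncated sums `evenMZVSum (2 * n) k`. -/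
noncomputable def evenMZVTrunc (N k : ℕ) : PowerSeries ℝ :=
  ∑ T ∈ (Finset.Icc 1 N).powersetCard k, ∏ m ∈ T, invSqGeom m

/-- The coefficient of `X ^ n` in `sin (π √X) / (π √X)`. -/
noncomputable def sineCoeff (n : ℕ) : ℝ :=
  (-1) ^ n * Real.pi ^ (2 * n) / (2 * n + 1).factorial

/-- The coefficient of `X ^ n` in `π √X / sin (π √X)`. -/
noncomputable def cosecCoeff (n : ℕ) : ℝ :=
  (-1) ^ n * Real.pi ^ (2 * n) * (2 - 2 ^ (2 * n)) * ((bernoulli (2 * n) : ℚ) : ℝ) /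
    (2 * n).factorial

open PowerSeries in
theorem one_sub_mul_invSqGeom (m : ℕ) :
    (1 - C (1 / (m : ℝ) ^ 2) * X) * invSqGeom m = C (1 / (m : ℝ) ^ 2) * X := by
  ext c
  rw [sub_mul, one_mul, mul_assoc, map_sub, coeff_C_mul, coeff_C_mul]
  rcases c with _ | _ | c
  · simp [invSqGeom]
  · rw [coeff_succ_X_mul]
    simp [invSqGeom]
  · rw [coeff_succ_X_mul, coeff_X]
    simp [invSqGeom]
    ring

theorem coeff_sineTrunc_mul_evenMZVTrunc (N n k : ℕ) :
    PowerSeries.coeff n (sineTrunc N * evenMZVTrunc N k) =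
      (-1) ^ k * (n.choose k : ℝ) * PowerSeries.coeff n (sineTrunc N) :=
  coeff_prod_one_sub_mul_sum_prod (fun m : ℕ => 1 / (m : ℝ) ^ 2) invSqGeom
    one_sub_mul_invSqGeom _ _ _

open Finset in
theorem sum_cosecCoeff_mul_sineCoeff (n : ℕ) :
    ∑ p ∈ antidiagonal n, cosecCoeff p.1 * sineCoeff p.2 = if n = 0 then 1 else 0 := by
  have h := congrArg (fun q : ℚ => (-1) ^ n * Real.pi ^ (2 * n) * (q : ℝ))
    (sum_two_sub_two_pow_bernoulli n)
  simp only [Rat.cast_sum, mul_sum] at h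
  have e : ((-1) ^ n * Real.pi ^ (2 * n) * ((if n = 0 then 1 else 0 : ℚ) : ℝ)) =
      if n = 0 then 1 else 0 := by
    split_ifs with h0 <;> simp [h0]
  rw [← e, ← h]
  refine sum_congr rfl fun p hp => ?_
  rw [HasAntidiagonal.mem_antidiagonal] at hp
  rw [← hp, cosecCoeff, sineCoeff]
  push_cast
  ring

open Finset in
/-- Newton's identity for the power sums `ζ (2 j)` in the squares of the reciprocals of
the positive integers. -/
theorem sum_zeta_mul_sineCoeff (n : ℕ) :
    ∑ p ∈ antidiagonal n, sineCoeff p.1 *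
      (if p.2 = 0 then 0 else ∑' m : ℕ, 1 / (m : ℝ) ^ (2 * p.2)) = - n * sineCoeff n := by
  have h := congrArg (fun q : ℚ => (-1) ^ n * Real.pi ^ (2 * n) / 2 * (q : ℝ))
    (sum_bernoulli_div_factorial n)
  simp only [Rat.cast_sum, mul_sum] at h
  rw [← Nat.sum_antidiagonal_swap] at h
  -- Euler's formula for ζ(2j) would give -1/2 at j = 0, where the sum has 0; the term at `(n, 0)`
  -- corrects for this.
  have key : ∀ p ∈ antidiagonal n, sineCoeff p.1 *
      (if p.2 = 0 then 0 else ∑' m : ℕ, 1 / (m : ℝ) ^ (2 * p.2)) =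
      (if p = (n, 0) then sineCoeff n / 2 else 0) - (-1) ^ n * Real.pi ^ (2 * n) / 2 *
      (((2 ^ (2 * p.2) * bernoulli (2 * p.2) / (2 * p.2).factorial : ℚ) *
      (1 / (2 * p.1 + 1).factorial) : ℚ) : ℝ) := by
    rintro ⟨a, b⟩ hp
    rw [HasAntidiagonal.mem_antidiagonal] at hp
    simp only at hp ⊢
    rcases b with _ | b
    · simp only [add_zero] at hp
      subst hp
      simp [sineCoeff]
      ring
    · rw [if_neg (by omega), if_neg (by simp), (hasSum_zeta_nat (Nat.add_one_ne_zero b)).tsum_eq, ← hp,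
        sineCoeff, show 2 * (b + 1) - 1 = 2 * b + 1 by omega]
      push_cast
      ring
  rw [sum_congr rfl key, sum_sub_distrib]
  simp only [Prod.swap] at h
  rw [h, sum_ite_eq' , if_pos (by simp), sineCoeff, Nat.factorial_succ]
  have : ((2 * n).factorial : ℝ) ≠ 0 := by positivity
  push_cast
  field_simp
  ring

/-! ### Coefficientwise limit of the sine product -/

open Filter Topology Finset

theorem tendsto_coeff_evenMZVTrunc_one (n : ℕ) :
    Tendsto (fun N => PowerSeries.coeff n (evenMZVTrunc N 1)) atTop
      (𝓝 (if n = 0 then 0 else ∑' m : ℕ, 1 / (m : ℝ) ^ (2 * n))) := by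
  rcases Nat.eq_zero_or_pos n with rfl | hn
  · simp [evenMZVTrunc, invSqGeom, powersetCard_one]
  · have h := (hasSum_zeta_nat hn.ne').summable.hasSum.tendsto_sum_nat
    rw [if_neg hn.ne']
    -- The extra term m = 0 is 1/0 = 0.
    refine (h.comp (tendsto_add_atTop_nat 1)).congr fun N => ?_
    simp only [evenMZVTrunc, powersetCard_one, sum_map, Function.comp, map_sum]
    rw [sum_range_succ', ← Ico_add_one_right_eq_Icc]
    simp [invSqGeom, hn.ne', pow_mul, sum_Ico_eq_sum_range, add_comm]

/-- The case k = 1 of the finite identity is Newton's recursion for the truncated product; its limit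
is the recursion satisfied by `sineCoeff`. No analytic sine product is needed. -/
theorem tendsto_coeff_sineTrunc (n : ℕ) :
    Tendsto (fun N => PowerSeries.coeff n (sineTrunc N)) atTop (𝓝 (sineCoeff n)) := by
  induction n using Nat.strong_induction_on with
  | _ n ih =>
    rcases Nat.eq_zero_or_pos n with rfl | hn
    · simp [sineTrunc, sineCoeff, map_prod]
    · have hn' : (n : ℝ) ≠ 0 := by positivity
      have hN : ∀ N, PowerSeries.coeff n (sineTrunc N) = -(1 / n) *
          ∑ p ∈ antidiagonal n, PowerSeries.coeff p.1 (sineTrunc N) *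
            PowerSeries.coeff p.2 (evenMZVTrunc N 1) := by
        intro N
        have := coeff_sineTrunc_mul_evenMZVTrunc N n 1
        rw [PowerSeries.coeff_mul] at this
        rw [this]
        simp
        field_simp
      have hs : sineCoeff n = -(1 / n) * ∑ p ∈ antidiagonal n, sineCoeff p.1 *
          (if p.2 = 0 then 0 else ∑' m : ℕ, 1 / (m : ℝ) ^ (2 * p.2)) := by
        rw [sum_zeta_mul_sineCoeff]
        field_simp
      rw [hs]
      simp only [hN]
      refine (tendsto_finsetSum _ fun p hp => ?_).const_mul _
      -- The term with `p.1 = n` vanishes, so the induction hypothesis covers the rest.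
      rcases Nat.eq_zero_or_pos p.2 with h0 | h0
      · have : ∀ N, PowerSeries.coeff p.2 (evenMZVTrunc N 1) = 0 := by
          intro N
          simp [h0, evenMZVTrunc, invSqGeom, powersetCard_one]
        simp only [this, if_pos h0, mul_zero, tendsto_const_nhds]
      · rw [HasAntidiagonal.mem_antidiagonal] at hp
        exact (ih p.1 (by omega)).mul (tendsto_coeff_evenMZVTrunc_one p.2)

/-! ### Decreasing tuples as k-element sets -/

/-- The set `{n₁, …, n_k}` of a tuple of summation indices. -/
def MZVIndex.toFinset {k : ℕ} (m : MZVIndex k) : Finset ℕ := univ.image m.1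

theorem MZVIndex.toFinset_injective {k : ℕ} :
    Function.Injective (MZVIndex.toFinset (k := k)) := by
  intro m m' h
  have h' : Set.range m.1 = Set.range m'.1 := by
    simpa [MZVIndex.toFinset, ← coe_inj] using h
  exact Subtype.ext (StrictAnti.range_inj m.2.1 m'.2.1 |>.1 h')

theorem MZVIndex.prod_toFinset {k : ℕ} {M : Type*} [CommMonoid M] (m : MZVIndex k)
    (f : ℕ → M) : ∏ a ∈ m.toFinset, f a = ∏ j, f (m.1 j) :=
  prod_image fun _ _ _ _ h => m.2.1.injective h

theorem MZVIndex.card_toFinset {k : ℕ} (m : MZVIndex k) : m.toFinset.card = k := by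
  rw [MZVIndex.toFinset, card_image_of_injective _ m.2.1.injective, card_univ, Fintype.card_fin]

/-- The tuples of summation indices with `n₁ ≤ N`. -/
noncomputable def mzvIndexLE (k N : ℕ) : Finset (MZVIndex k) :=
  (Fintype.piFinset fun _ => range (N + 1)).preimage Subtype.val
    Subtype.val_injective.injOn

theorem mem_mzvIndexLE {k N : ℕ} {m : MZVIndex k} :
    m ∈ mzvIndexLE k N ↔ ∀ j, m.1 j ≤ N := by
  simp [mzvIndexLE]

theorem tendsto_mzvIndexLE (k : ℕ) : Tendsto (mzvIndexLE k) atTop atTop := by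
  refine tendsto_atTop_finset_of_monotone (fun N N' h m hm => ?_) fun m => ?_
  · exact mem_mzvIndexLE.2 fun j => (mem_mzvIndexLE.1 hm j).trans h
  · exact ⟨∑ j, m.1 j, mem_mzvIndexLE.2 fun j =>
      single_le_sum (f := m.1) (fun _ _ => Nat.zero_le _) (mem_univ j)⟩

theorem sum_mzvIndexLE {M : Type*} [AddCommMonoid M] (k N : ℕ) (F : Finset ℕ → M) :
    ∑ m ∈ mzvIndexLE k N, F m.toFinset = ∑ T ∈ (Icc 1 N).powersetCard k, F T := by
  refine sum_bij (fun m _ => m.toFinset) ?_ (fun _ _ _ _ h => MZVIndex.toFinset_injective h) ?_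
    fun _ _ => rfl
  · intro m hm
    refine mem_powersetCard.2 ⟨fun a ha => ?_, m.card_toFinset⟩
    obtain ⟨j, -, rfl⟩ := mem_image.1 ha
    exact mem_Icc.2 ⟨m.2.2 j, mem_mzvIndexLE.1 hm j⟩
  · intro T hT
    obtain ⟨hT, hc⟩ := mem_powersetCard.1 hT
    have hmem : ∀ j, T.orderEmbOfFin hc (Fin.rev j) ∈ Icc 1 N := fun j =>
      hT (orderEmbOfFin_mem _ _ _)
    refine ⟨⟨fun j => T.orderEmbOfFin hc (Fin.rev j), fun i j hij =>
      (T.orderEmbOfFin hc).strictMono (Fin.rev_lt_rev.2 hij), fun j => (mem_Icc.1 (hmem j)).1⟩,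
      mem_mzvIndexLE.2 fun j => (mem_Icc.1 (hmem j)).2, ?_⟩
    refine eq_of_subset_of_card_le (fun a ha => ?_) (by rw [MZVIndex.card_toFinset, hc])
    obtain ⟨j, -, rfl⟩ := mem_image.1 ha
    exact orderEmbOfFin_mem _ _ _

/-! ### Convergence and limit of the truncated sums -/

theorem mem_evenCompositions {w k : ℕ} {i : Fin k → ℕ} :
    i ∈ evenCompositions w k ↔ ∑ j, i j = w ∧ ∀ j, 0 < i j ∧ Even (i j) := by
  simp [evenCompositions, Nat.mem_antidiagonalTuple]

theorem summable_mzvTerm {w k : ℕ} {i : Fin k → ℕ} (hi : i ∈ evenCompositions w k) :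
    Summable (mzvTerm i) := by
  -- Every exponent is at least 2, so products of 1/a² over finite sets dominate.
  have h1 : Summable fun m : MZVIndex k => ∏ a ∈ m.toFinset, 1 / (a : ℝ) ^ 2 :=
    (summable_finsetProd_of_summable_nonneg (fun a : ℕ => by positivity)
      (Real.summable_one_div_nat_pow.2 one_lt_two)).comp_injective MZVIndex.toFinset_injective
  refine h1.of_nonneg_of_le (fun m => by unfold mzvTerm; positivity) fun m => ?_
  rw [MZVIndex.prod_toFinset, mzvTerm, one_div, ← prod_inv_distrib]
  refine prod_le_prod (fun j _ => by positivity) fun j _ => ?_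
  have h1 : (1 : ℝ) ≤ m.1 j := by exact_mod_cast m.2.2 j
  obtain ⟨hpos, c, hc⟩ := (mem_evenCompositions.1 hi).2 j
  rw [one_div]
  exact inv_anti₀ (by positivity) (pow_le_pow_right₀ h1 (by omega))

theorem sum_evenCompositions_mzvTerm {n k : ℕ} (m : MZVIndex k) :
    ∑ i ∈ evenCompositions (2 * n) k, mzvTerm i m =
      PowerSeries.coeff n (∏ a ∈ m.toFinset, invSqGeom a) := by
  rw [MZVIndex.prod_toFinset, PowerSeries.coeff_prod]
  symm
  -- Halve the exponents; a zero exponent contributes nothing because `invSqGeom` has no constant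
  -- term.
  refine sum_bij_ne_zero (fun l _ _ j => 2 * l j) ?_ ?_ ?_ ?_
  · intro l hl h
    rw [mem_evenCompositions, ← mul_sum, (mem_finsuppAntidiag.1 hl).1]
    refine ⟨rfl, fun j => ⟨?_, even_two_mul _⟩⟩
    have := prod_ne_zero_iff.1 h j (mem_univ j)
    rcases Nat.eq_zero_or_pos (l j) with h0 | h0
    · simp [invSqGeom, h0] at this
    · omega
  · intro l _ _ l' _ _ h
    ext j
    have : 2 * l j = 2 * l' j := congrFun h j
    omega
  · intro i hi _
    obtain ⟨hs, hp⟩ := mem_evenCompositions.1 hi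
    have h2 : ∀ j, 2 * (i j / 2) = i j := fun j => Nat.two_mul_div_two_of_even (hp j).2
    refine ⟨Finsupp.equivFunOnFinite.symm fun j => i j / 2, ?_, ?_, ?_⟩
    · refine mem_finsuppAntidiag.2 ⟨?_, subset_univ _⟩
      have : 2 * ∑ j, i j / 2 = 2 * n := by rw [mul_sum, ← hs]; exact sum_congr rfl fun j _ => h2 j
      simpa using this
    · refine prod_ne_zero_iff.2 fun j _ => ?_
      have h0 : i j / 2 ≠ 0 := by have := h2 j; have := (hp j).1; omega
      have h1 : m.1 j ≠ 0 := Nat.one_le_iff_ne_zero.1 (m.2.2 j)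
      simp only [invSqGeom, PowerSeries.coeff_mk, Finsupp.equivFunOnFinite_symm_apply_apply,
        if_neg h0]
      positivity
    · funext j
      simpa using h2 j
  · intro l hl h
    rw [mzvTerm, one_div, ← prod_inv_distrib]
    refine prod_congr rfl fun j _ => ?_
    have := prod_ne_zero_iff.1 h j (mem_univ j)
    rcases Nat.eq_zero_or_pos (l j) with h0 | h0
    · simp [invSqGeom, h0] at this
    · simp [invSqGeom, h0.ne', pow_mul]

theorem tendsto_coeff_evenMZVTrunc (n k : ℕ) :
    Tendsto (fun N => PowerSeries.coeff n (evenMZVTrunc N k)) atTop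
      (𝓝 (evenMZVSum (2 * n) k)) := by
  have h : Tendsto (fun N => ∑ i ∈ evenCompositions (2 * n) k,
      ∑ m ∈ mzvIndexLE k N, mzvTerm i m) atTop (𝓝 (evenMZVSum (2 * n) k)) :=
    tendsto_finsetSum _ fun i hi => (summable_mzvTerm hi).hasSum.comp (tendsto_mzvIndexLE k)
  refine h.congr fun N => ?_
  rw [sum_comm, evenMZVTrunc, map_sum, ← sum_mzvIndexLE]
  exact sum_congr rfl fun m _ => sum_evenCompositions_mzvTerm m

/-! ### Inverting the sine series and the closed form -/

open PowerSeries in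
theorem evenMZVSum_eq_sum_cosecCoeff (n k : ℕ) :
    evenMZVSum (2 * n) k = ∑ p ∈ antidiagonal n,
      cosecCoeff p.1 * ((-1) ^ k * (p.2.choose k : ℝ) * sineCoeff p.2) := by
  have h1 : PowerSeries.mk sineCoeff * PowerSeries.mk (fun n => evenMZVSum (2 * n) k) =
      PowerSeries.mk fun n => (-1) ^ k * (n.choose k : ℝ) * sineCoeff n := by
    ext n
    rw [coeff_mul, coeff_mk]
    simp only [coeff_mk]
    refine tendsto_nhds_unique (f := fun N => coeff n (sineTrunc N * evenMZVTrunc N k))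
      (l := atTop) ?_ ?_
    · simp only [coeff_mul]
      exact tendsto_finsetSum _ fun p _ =>
        (tendsto_coeff_sineTrunc p.1).mul (tendsto_coeff_evenMZVTrunc p.2 k)
    · simp only [coeff_sineTrunc_mul_evenMZVTrunc]
      exact (tendsto_coeff_sineTrunc n).const_mul _
  have h2 : PowerSeries.mk cosecCoeff * PowerSeries.mk sineCoeff = 1 := by
    ext n
    rw [coeff_mul, coeff_one, ← sum_cosecCoeff_mul_sineCoeff]
    simp only [coeff_mk]
  have h3 := congrArg (coeff n) (congrArg (PowerSeries.mk cosecCoeff * ·) h1)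
  simp only [← mul_assoc, h2, one_mul] at h3
  simpa only [coeff_mul, coeff_mk] using h3

theorem theorem3 (n k : ℕ) (hk : 1 ≤ k) (hkn : k ≤ n) :
    (∀ i ∈ evenCompositions (2 * n) k, Summable (mzvTerm i)) ∧
    evenMZVSum (2 * n) k =
      (-1 : ℝ) ^ ((n : ℤ) - (k : ℤ) - 1) * Real.pi ^ (2 * n) / ((2 * n + 1).factorial : ℝ) *
        ∑ i ∈ Finset.range (n - k + 1),
          ((n - i).choose k : ℝ) * ((2 * n + 1).choose (2 * i) : ℝ) *
            (2 * ((2 : ℝ) ^ (2 * (i : ℤ) - 1) - 1)) * ((bernoulli (2 * i) : ℚ) : ℝ) := by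
  refine ⟨fun i hi => summable_mzvTerm hi, ?_⟩
  rw [evenMZVSum_eq_sum_cosecCoeff,
    Nat.sum_antidiagonal_eq_sum_range_succ (fun a b => cosecCoeff a *
      ((-1) ^ k * (b.choose k : ℝ) * sineCoeff b)), mul_sum]
  symm
  -- For i > n - k the factor binom(n-i,k) is zero.
  have hsub : range (n - k + 1) ⊆ range n.succ := range_subset_range.2 (by omega)
  rw [← sum_subset hsub]
  · refine sum_congr rfl fun i hi => ?_
    rw [mem_range] at hi
    have hin : i ≤ n := by omega
    have hpow : (2 : ℝ) ^ (2 * (i : ℤ) - 1) = 2 ^ (2 * i) / 2 := by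
      rw [zpow_sub₀ two_ne_zero, zpow_one]
      norm_cast
    have hsign : (-1 : ℝ) ^ ((n : ℤ) - (k : ℤ) - 1) = - ((-1) ^ n * (-1) ^ k) := by
      rw [zpow_sub₀ (by norm_num), zpow_sub₀ (by norm_num)]
      rcases neg_one_pow_eq_or ℝ k with h | h <;> simp [h, div_neg]
    have hsplit : (-1 : ℝ) ^ n = (-1) ^ i * (-1) ^ (n - i) := by
      rw [← pow_add, Nat.add_sub_cancel' hin]
    have hpi : Real.pi ^ (2 * n) = Real.pi ^ (2 * i) * Real.pi ^ (2 * (n - i)) := by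
      rw [← pow_add, ← mul_add, Nat.add_sub_cancel' hin]
    have hfac : 2 * n + 1 - 2 * i = 2 * (n - i) + 1 := by omega
    rw [Nat.cast_choose ℝ (show 2 * i ≤ 2 * n + 1 by omega), hfac, hpow, hsign, hsplit, hpi,
      cosecCoeff, sineCoeff]
    have : ((2 * n + 1).factorial : ℝ) ≠ 0 := by positivity
    field_simp
    ring
  · intro i _ hi
    rw [mem_range, not_lt] at hi
    rw [Nat.choose_eq_zero_of_lt (show n - i < k by omega)]
    simp
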